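/- Let $G$ be a nontrivial finite abelian group. For a finite dimensional complex representation $V$ of $G$, let $\beta_{\mathrm{sep}}(G,V)$ be the minimal positive integer $d$ such that for any $v,w\in V$ with different $G$-orbits there is a homogeneous $G$-invariant polynomial function $f\in\mathbb{C}[V]^G$ of degree at most $d$ with $f(v)\neq f(w)$, and let $\beta_{\mathrm{sep}}(G)$ be the supremum of $\beta_{\mathrm{sep}}(G,V)$ over all finite dimensional complex representations $V$ of $G$. Let $\exp(G)$ be the exponent of $G$ (the least common multiple of the orders of its elements) and $\operatorname{rank}(G)$ the minimal number of generators of $G$. Then \[\beta_{\mathrm{sep}}(G)\le\left\lfloor\frac{\exp(G)\cdot(\operatorname{rank}(G)+1)}{2}\right\rfloor .\] -/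

import Mathlib

/-- The homogeneous polynomial functions of degree `k` on a complex vector space `V`:
the linear span, inside the functions `V → ℂ`, of the products of `k` linear functionals.
For `V = ℂⁿ` these are the functions given by the homogeneous polynomials of degree `k`
in the `n` coordinates. -/
def homogeneousPolyFun (V : Type*) [AddCommGroup V] [Module ℂ V] (k : ℕ) :
    Submodule ℂ (V → ℂ) :=
  Submodule.span ℂ {f | ∃ φ : Fin k → Module.Dual ℂ V, f = fun v => ∏ i, φ i v}

/-- `f` is constant on the orbits of the linear action `ρ` of `G` on `V`. -/
def IsInvariantFun {G V : Type*} [Group G] [AddCommGroup V] [Module ℂ V]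
    (ρ : Representation ℂ G V) (f : V → ℂ) : Prop :=
  ∀ (g : G) (v : V), f (ρ g v) = f v

/-- `v` and `w` lie in the same orbit of the linear action `ρ`. -/
def SameOrbit {G V : Type*} [Group G] [AddCommGroup V] [Module ℂ V]
    (ρ : Representation ℂ G V) (v w : V) : Prop :=
  ∃ g : G, ρ g v = w

/-- Any two points in different orbits are separated by a homogeneous invariant polynomial
function of degree at most `d`. -/
def SeparatesInDegree {G V : Type*} [Group G] [AddCommGroup V] [Module ℂ V]
    (ρ : Representation ℂ G V) (d : ℕ) : Prop :=
  ∀ v w : V, ¬ SameOrbit ρ v w →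
    ∃ k ≤ d, ∃ f ∈ homogeneousPolyFun V k, IsInvariantFun ρ f ∧ f v ≠ f w

/-- `β_sep(G, V)`: the minimal positive integer `d` such that the homogeneous invariants of
degree at most `d` separate the orbits (it would be `⊤` if there were no such `d`). -/
noncomputable def betaSepRep {G V : Type*} [Group G] [AddCommGroup V] [Module ℂ V]
    (ρ : Representation ℂ G V) : ℕ∞ :=
  ⨅ (d : ℕ) (_ : 0 < d ∧ SeparatesInDegree ρ d), (d : ℕ∞)

/-- The separating Noether number `β_sep(G)`: the supremum, taken in `ℕ ∪ {∞}`, of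
`β_sep(G, V)` over all finite dimensional complex representations `V` of `G`. (Each of them
is isomorphic to one whose underlying space is in `Type`.) -/
noncomputable def betaSep (G : Type*) [Group G] : ℕ∞ :=
  ⨆ (V : Type) (_ : AddCommGroup V) (_ : Module ℂ V) (_ : FiniteDimensional ℂ V)
    (ρ : Representation ℂ G V), betaSepRep ρ

/-! Let `n` be the exponent and `r` the rank of `G`, and let no invariant of degree at most `d =
⌊n(r+1)/2⌋` separate `v` from `w`. Functionals `ψ` on which `G` acts by a character `χ` detect
vectors, so it suffices to find `g` with `χ g = ψ w / ψ v` whenever `ψ v ≠ 0`. By duality `g` exists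
once every multiplicative relation among the `χ` also holds among these ratios, which are `n`-th
roots of unity. Relations involving at most `r + 1` characters suffice
(`linearCombination_eq_zero_of_card_support_le`). For these, take exponents `b i` in `[0, n)`:
either `b` or `n - b` has sum at most `d` and gives an invariant monomial
(`linearCombination_eq_zero_of_sum_le`). -/

/-! ### Generating finite abelian groups up to index prime to `p` -/

theorem card_ker_eq_card_quotient_range {A : Type*} [AddCommGroup A] [Finite A] (f : A →+ A) :
    Nat.card f.ker = Nat.card (A ⧸ f.range) := by
  have h1 := AddSubgroup.card_eq_card_quotient_mul_card_addSubgroup f.ker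
  rw [Nat.card_congr (QuotientAddGroup.quotientKerEquivRange f).toEquiv] at h1
  have h2 := AddSubgroup.card_eq_card_quotient_mul_card_addSubgroup f.range
  have h3 : 0 < Nat.card f.range := Nat.card_pos
  exact Nat.eq_of_mul_eq_mul_left h3 (by linarith)

open Module in
theorem card_ker_nsmul_le_pow {A : Type*} [AddCommGroup A] [Finite A] {p : ℕ} (hp : p.Prime)
    (S : Finset A) (hS : AddSubgroup.closure (S : Set A) = ⊤) :
    Nat.card (nsmulAddMonoidHom (α := A) p).ker ≤ p ^ S.card := by
  have : Fact p.Prime := ⟨hp⟩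
  set f := nsmulAddMonoidHom (α := A) p with hf
  have hker := card_ker_eq_card_quotient_range f
  obtain ⟨_⟩ : Nonempty (Module (ZMod p) (A ⧸ f.range)) :=
    ⟨QuotientAddGroup.zmodModule fun x => ⟨x, rfl⟩⟩
  classical
  have hspan : Submodule.span (ZMod p)
      ((S.image (QuotientAddGroup.mk' f.range) : Finset (A ⧸ f.range)) : Set (A ⧸ f.range)) = ⊤ := by
    rw [eq_top_iff]
    rintro x -
    obtain ⟨a, rfl⟩ := QuotientAddGroup.mk'_surjective f.range x
    have ha : a ∈ AddSubgroup.closure (S : Set A) := hS ▸ AddSubgroup.mem_top a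
    induction ha using AddSubgroup.closure_induction with
    | mem y hy => exact Submodule.subset_span (by simpa using ⟨y, hy, rfl⟩)
    | zero => simp
    | add y z _ _ hy hz => rw [map_add]; exact add_mem hy hz
    | neg y _ hy => rw [map_neg]; exact neg_mem hy
  rw [hker, Module.natCard_eq_pow_finrank (K := ZMod p), Nat.card_zmod]
  refine Nat.pow_le_pow_right hp.pos ?_
  have h := finrank_span_finset_le_card (R := ZMod p)
    (S.image (QuotientAddGroup.mk' f.range))
  rw [Set.finrank, hspan, finrank_top] at h
  exact h.trans Finset.card_image_le

open Module in
-- Lift a basis of `B/pB` chosen among the images of the `x i`. The lifts span `N` with `B = N +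
-- pB`, so `p` acts bijectively on `B/N`, and `m = |B/N|` is prime to `p`.
theorem exists_finset_smul_mem_span_of_span_eq_top {B ι : Type*} [AddCommGroup B] [Finite B]
    {p r : ℕ} (hp : p.Prime) (hB : Nat.card (nsmulAddMonoidHom (α := B) p).ker ≤ p ^ r)
    (x : ι → B) (hx : Submodule.span ℤ (Set.range x) = ⊤) :
    ∃ (T : Finset ι) (m : ℕ), T.card ≤ r ∧ ¬ p ∣ m ∧
      ∀ b, m • b ∈ Submodule.span ℤ (x '' (T : Set ι)) := by
  have : Fact p.Prime := ⟨hp⟩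
  set f := nsmulAddMonoidHom (α := B) p with hf
  have hker := card_ker_eq_card_quotient_range f
  obtain ⟨_⟩ : Nonempty (Module (ZMod p) (B ⧸ f.range)) :=
    ⟨QuotientAddGroup.zmodModule fun x => ⟨x, rfl⟩⟩
  set q := QuotientAddGroup.mk' f.range with hq
  obtain ⟨κ, a, ha, hspan, hli⟩ := exists_linearIndependent' (ZMod p) (q ∘ x)
  have : Finite κ := hli.finite
  have : Fintype κ := Fintype.ofFinite κ
  classical
  set T : Finset ι := Finset.univ.image a with hT
  have hTr : T.card ≤ r := by
    have h1 : Fintype.card κ ≤ finrank (ZMod p) (B ⧸ f.range) := hli.fintype_card_le_finrank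
    have h2 : p ^ finrank (ZMod p) (B ⧸ f.range) ≤ p ^ r := by
      rw [hker, Module.natCard_eq_pow_finrank (K := ZMod p), Nat.card_zmod] at hB
      exact hB
    exact (Finset.card_image_le.trans h1).trans ((Nat.pow_le_pow_iff_right hp.one_lt).1 h2)
  set N := Submodule.span ℤ (x '' (T : Set ι)) with hN
  have key : ∀ y ∈ Submodule.span (ZMod p) (Set.range ((q ∘ x) ∘ a)), ∃ b ∈ N, q b = y := by
    intro y hy
    induction hy using Submodule.span_induction with
    | mem y hy =>
      obtain ⟨k, rfl⟩ := hy
      exact ⟨x (a k), Submodule.subset_span ⟨a k, by simp [hT], rfl⟩, rfl⟩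
    | zero => exact ⟨0, zero_mem _, map_zero _⟩
    | add y z _ _ hy hz =>
      obtain ⟨b, hb, rfl⟩ := hy
      obtain ⟨c, hc, rfl⟩ := hz
      exact ⟨b + c, add_mem hb hc, map_add _ _ _⟩
    | smul c y _ hy =>
      obtain ⟨b, hb, rfl⟩ := hy
      refine ⟨c.val • b, nsmul_mem hb _, ?_⟩
      rw [map_nsmul, ← Nat.cast_smul_eq_nsmul (ZMod p), ZMod.natCast_val, ZMod.cast_id]
  have hall : ∀ y : B ⧸ f.range, y ∈ Submodule.span (ZMod p) (Set.range (q ∘ x)) := by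
    intro y
    obtain ⟨b, rfl⟩ := QuotientAddGroup.mk'_surjective f.range y
    have hb : b ∈ Submodule.span ℤ (Set.range x) := hx ▸ Submodule.mem_top
    induction hb using Submodule.span_induction with
    | mem z hz =>
      obtain ⟨i, rfl⟩ := hz
      exact Submodule.subset_span ⟨i, rfl⟩
    | zero => simp
    | add y z _ _ hy hz => rw [map_add]; exact add_mem hy hz
    | smul c y _ hy => rw [map_zsmul]; exact zsmul_mem hy c
  have hsurj : Function.Surjective (fun y : B ⧸ N => p • y) := by
    intro y
    obtain ⟨b, rfl⟩ := N.mkQ_surjective y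
    obtain ⟨c, hc, hcb⟩ := key (q b) (hspan ▸ hall (q b))
    have : -c + b ∈ f.range := QuotientAddGroup.eq.1 hcb
    obtain ⟨d, hd⟩ := this
    refine ⟨N.mkQ d, ?_⟩
    have hd' : p • d = -c + b := hd
    have hc0 : N.mkQ c = 0 := by simpa using hc
    change p • N.mkQ d = N.mkQ b
    rw [← map_nsmul, hd', map_add, map_neg, hc0, neg_zero, zero_add]
  have : Finite (B ⧸ N) := Finite.of_surjective _ N.mkQ_surjective
  refine ⟨T, Nat.card (B ⧸ N), hTr, fun hdvd => ?_, fun b => ?_⟩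
  · obtain ⟨y, hy⟩ := exists_prime_addOrderOf_dvd_card' p hdvd
    have hinj := Finite.injective_iff_surjective.2 hsurj
    have : y = 0 := hinj (by simpa [hy] using addOrderOf_nsmul_eq_zero y)
    rw [this, addOrderOf_zero] at hy
    exact hp.one_lt.ne hy
  · rw [← Submodule.Quotient.mk_eq_zero, Submodule.Quotient.mk_smul]
    exact card_nsmul_eq_zero'

/-- Bounding the `p`-torsion, rather than the number of generators, makes the hypothesis pass to the
subgroup spanned by `x` at once. -/
theorem exists_finset_smul_mem_span {A ι : Type*} [AddCommGroup A] [Finite A]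
    {p r : ℕ} (hp : p.Prime) (hA : Nat.card (nsmulAddMonoidHom (α := A) p).ker ≤ p ^ r)
    (x : ι → A) :
    ∃ (T : Finset ι) (m : ℕ), T.card ≤ r ∧ ¬ p ∣ m ∧
      ∀ i, m • x i ∈ Submodule.span ℤ (x '' (T : Set ι)) := by
  set B := Submodule.span ℤ (Set.range x) with hBdef
  set x' : ι → B := fun i => ⟨x i, Submodule.subset_span ⟨i, rfl⟩⟩ with hx'
  have himg : ∀ s : Set ι, (Submodule.span ℤ (x' '' s)).map B.subtype =
      Submodule.span ℤ (x '' s) := by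
    intro s
    rw [Submodule.map_span, Set.image_image]
    rfl
  have htop : Submodule.span ℤ (Set.range x') = ⊤ := by
    apply Submodule.map_injective_of_injective B.subtype_injective
    rw [← Set.image_univ, himg, Set.image_univ, Submodule.map_subtype_top]
  have hB : Nat.card (nsmulAddMonoidHom (α := B) p).ker ≤ p ^ r := by
    refine le_trans (Nat.card_le_card_of_injective
      (fun b => (⟨b.1.1, ?_⟩ : (nsmulAddMonoidHom (α := A) p).ker)) ?_) hA
    · have := b.2
      rw [AddMonoidHom.mem_ker] at this ⊢
      exact congrArg Subtype.val this
    · intro b c hbc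
      exact Subtype.ext (Subtype.ext (by simpa using hbc))
  obtain ⟨T, m, hT, hm, h⟩ := exists_finset_smul_mem_span_of_span_eq_top hp hB x' htop
  refine ⟨T, m, hT, hm, fun i => ?_⟩
  rw [← himg]
  exact ⟨_, h (x' i), rfl⟩

/-! ### Reduction to relations of small support and small degree -/

theorem linearCombination_eq_zero_of_card_support_le {A M ι : Type*} [AddCommGroup A] [Finite A]
    [AddCommGroup M] {r : ℕ}
    (hA : ∀ p : ℕ, p.Prime → Nat.card (nsmulAddMonoidHom (α := A) p).ker ≤ p ^ r)
    (x : ι → A) (z : ι → M)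
    (h : ∀ a : ι →₀ ℤ, a.support.card ≤ r + 1 → Finsupp.linearCombination ℤ x a = 0 →
      Finsupp.linearCombination ℤ z a = 0)
    (a : ι →₀ ℤ) (ha : Finsupp.linearCombination ℤ x a = 0) :
    Finsupp.linearCombination ℤ z a = 0 := by
  classical
  rw [← AddMonoid.addOrderOf_eq_one_iff]
  by_contra hne
  have hp := Nat.minFac_prime hne
  -- It is enough that some `m` prime to `p` kills the element. An infinite order is recorded as
  -- `0`, with `minFac` equal to `2`, and the argument still applies.
  set p := (addOrderOf (Finsupp.linearCombination ℤ z a)).minFac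
  obtain ⟨T, m, hT, hm, hspan⟩ := exists_finset_smul_mem_span hp (hA p hp) x
  refine hm ((Nat.minFac_dvd _).trans (addOrderOf_dvd_of_nsmul_eq_zero ?_))
  have ht : ∀ i, ∃ t : ι →₀ ℤ, t.support ⊆ T ∧ Finsupp.linearCombination ℤ x t = m • x i := by
    intro i
    obtain ⟨t, ht, hti⟩ := (Finsupp.mem_span_image_iff_linearCombination ℤ).1 (hspan i)
    exact ⟨t, by simpa [Finsupp.mem_supported] using ht, hti⟩
  choose t htT ht using ht
  have hz : ∀ i, Finsupp.linearCombination ℤ z (t i) = m • z i := by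
    intro i
    have := h (t i - Finsupp.single i (m : ℤ)) ?_ ?_
    · rw [map_sub, sub_eq_zero, Finsupp.linearCombination_single, natCast_zsmul] at this
      exact this
    · refine le_trans (Finset.card_le_card (t := insert i T) ?_)
        ((Finset.card_insert_le _ _).trans (by omega))
      refine Finsupp.support_sub.trans (Finset.union_subset ?_ ?_)
      · exact (htT i).trans (Finset.subset_insert _ _)
      · exact Finsupp.support_single_subset.trans (by simp)
    · rw [map_sub, ht, Finsupp.linearCombination_single, natCast_zsmul, sub_self]
  -- Substituting `t i` for `m • i` turns `m • a` into a relation supported on `T`, with the same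
  -- value under `z`.
  set b : ι →₀ ℤ := Finsupp.linearCombination ℤ t a with hb
  have hbT : b.support ⊆ T := by
    have : b ∈ Finsupp.supported ℤ ℤ (T : Set ι) := by
      rw [hb, Finsupp.linearCombination_apply, Finsupp.sum]
      refine sum_mem fun i _ => zsmul_mem ?_ _
      simpa [Finsupp.mem_supported] using htT i
    simpa [Finsupp.mem_supported] using this
  have hxb : Finsupp.linearCombination ℤ x b = 0 := by
    rw [hb, Finsupp.linearCombination_apply ℤ (v := t), Finsupp.sum, map_sum]
    simp only [map_zsmul, ht]
    rw [Finsupp.linearCombination_apply, Finsupp.sum] at ha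
    simp only [smul_comm _ m, ← Finset.smul_sum, ha, smul_zero]
  have hzb := h b ((Finset.card_le_card hbT).trans (by omega)) hxb
  rw [hb, Finsupp.linearCombination_apply ℤ (v := t), Finsupp.sum, map_sum] at hzb
  simp only [map_zsmul, hz] at hzb
  rw [Finsupp.linearCombination_apply, Finsupp.sum, Finset.smul_sum]
  simpa only [smul_comm m] using hzb

theorem zsmul_eq_toNat_emod_nsmul {N : Type*} [AddCommGroup N] {n : ℕ} (hn : 0 < n) {y : N}
    (hy : n • y = 0) (a : ℤ) : a • y = (a % n).toNat • y := by
  have hb : ((a % n).toNat : ℤ) = a % n := Int.toNat_of_nonneg (Int.emod_nonneg _ (by omega))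
  rw [← natCast_zsmul, hb]
  conv_lhs => rw [← Int.mul_ediv_add_emod a n]
  rw [add_zsmul, mul_comm, mul_zsmul, natCast_zsmul, hy, zsmul_zero, zero_add]

theorem sub_toNat_emod_nsmul {N : Type*} [AddCommGroup N] {n : ℕ} (hn : 0 < n) {y : N}
    (hy : n • y = 0) (a : ℤ) : (n - (a % n).toNat) • y = -(a • y) := by
  have := Int.emod_lt_of_pos a (b := n) (by omega)
  rw [zsmul_eq_toNat_emod_nsmul hn hy, sub_nsmul _ (by omega), hy, zero_add]

theorem linearCombination_eq_zero_of_sum_le {A M ι : Type*} [AddCommGroup A] [AddCommGroup M]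
    {n r d : ℕ} (hn : 0 < n) (hd : n * (r + 1) ≤ 2 * d + 1) (x : ι → A) (z : ι → M)
    (hx : ∀ i, n • x i = 0) (hz : ∀ i, n • z i = 0)
    (h : ∀ (T : Finset ι) (b : ι → ℕ), ∑ i ∈ T, b i ≤ d → ∑ i ∈ T, b i • x i = 0 →
      ∑ i ∈ T, b i • z i = 0)
    (a : ι →₀ ℤ) (har : a.support.card ≤ r + 1) (ha : Finsupp.linearCombination ℤ x a = 0) :
    Finsupp.linearCombination ℤ z a = 0 := by
  rw [Finsupp.linearCombination_apply, Finsupp.sum] at ha ⊢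
  set T := a.support
  set b : ι → ℕ := fun i => (a i % n).toNat
  have hb : ∀ i, (b i : ℤ) = a i % n := fun i =>
    Int.toNat_of_nonneg (Int.emod_nonneg _ (by omega))
  have hbn : ∀ i, b i ≤ n := fun i => by
    have := Int.emod_lt_of_pos (a i) (b := n) (by omega)
    have := hb i
    omega
  by_cases hle : ∑ i ∈ T, b i ≤ d
  · rw [Finset.sum_congr rfl fun i _ => zsmul_eq_toNat_emod_nsmul hn (hx i) (a i)] at ha
    rw [Finset.sum_congr rfl fun i _ => zsmul_eq_toNat_emod_nsmul hn (hz i) (a i)]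
    exact h T b hle ha
  -- If `∑ b ≥ d + 1`, the complementary sum is at most `n(r+1) - d - 1 ≤ d`.
  · have hsum : ∑ i ∈ T, (n - b i) + ∑ i ∈ T, b i = n * T.card := by
      rw [← Finset.sum_add_distrib, Finset.sum_congr rfl fun i _ => Nat.sub_add_cancel (hbn i)]
      simp [mul_comm]
    have hTn : n * T.card ≤ n * (r + 1) := Nat.mul_le_mul_left n har
    have := h T (fun i => n - b i) (by omega) (by
      rw [Finset.sum_congr rfl fun i _ => sub_toNat_emod_nsmul hn (hx i) (a i), Finset.sum_neg_distrib, ha,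
        neg_zero])
    rwa [Finset.sum_congr rfl fun i _ => sub_toNat_emod_nsmul hn (hz i) (a i), Finset.sum_neg_distrib,
      neg_eq_zero] at this

/-! ### Invariant monomials in semi-invariant functionals -/

theorem prod_pow_mem_homogeneousPolyFun {V ι : Type*} [AddCommGroup V] [Module ℂ V]
    (ψ : ι → Module.Dual ℂ V) (T : Finset ι) (a : ι → ℕ) :
    (fun v => ∏ i ∈ T, ψ i v ^ a i) ∈ homogeneousPolyFun V (∑ i ∈ T, a i) := by
  refine Submodule.subset_span ?_
  classical
  induction T using Finset.induction_on with
  | empty =>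
    rw [Finset.sum_empty]
    exact ⟨Fin.elim0, by simp⟩
  | insert j T hj ih =>
    obtain ⟨φ, hφ⟩ := ih
    rw [Finset.sum_insert hj]
    refine ⟨Fin.append (fun _ => ψ j) φ, funext fun v => ?_⟩
    have := congrFun hφ v
    rw [Finset.prod_insert hj, this, Fin.prod_univ_add]
    simp

theorem isInvariantFun_prod_pow {G V ι : Type*} [CommGroup G] [AddCommGroup V] [Module ℂ V]
    (ρ : Representation ℂ G V) (χ : ι → G →* ℂˣ) (ψ : ι → Module.Dual ℂ V)
    (h : ∀ i g x, ψ i (ρ g x) = χ i g * ψ i x) (T : Finset ι) (a : ι → ℕ)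
    (hrel : ∏ i ∈ T, χ i ^ a i = 1) :
    IsInvariantFun ρ (fun v => ∏ i ∈ T, ψ i v ^ a i) := by
  intro g v
  have h1 : ∏ i ∈ T, (χ i g : ℂ) ^ a i = 1 := by
    have := congrArg (fun φ : G →* ℂˣ => (φ g : ℂ)) hrel
    simpa [MonoidHom.finsetProd_apply] using this
  simp only [h, mul_pow, Finset.prod_mul_distrib, h1, one_mul]

/-- Project a functional `l` with `l u ≠ 0` to each isotypic component; by orthogonality the
projections at `u` add up to `|G| • l u`. -/
theorem exists_semiinvariant_functional_ne_zero {G V : Type*} [CommGroup G] [Finite G]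
    [AddCommGroup V] [Module ℂ V] (ρ : Representation ℂ G V) {u : V} (hu : u ≠ 0) :
    ∃ (χ : G →* ℂˣ) (ψ : Module.Dual ℂ V), (∀ g x, ψ (ρ g x) = χ g * ψ x) ∧ ψ u ≠ 0 := by
  classical
  have : Fintype G := Fintype.ofFinite G
  have : Fintype (G →* ℂˣ) := Fintype.ofFinite _
  obtain ⟨l, hl⟩ : ∃ l : Module.Dual ℂ V, l u ≠ 0 := by
    by_contra! h
    exact hu ((Module.forall_dual_apply_eq_zero_iff ℂ u).1 h)
  by_contra! hcon
  let ψ : (G →* ℂˣ) → Module.Dual ℂ V := fun χ => ∑ g : G, (χ g⁻¹ : ℂ) • (l ∘ₗ ρ g)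
  have hψ : ∀ χ x, ψ χ x = ∑ g : G, (χ g⁻¹ : ℂ) * l (ρ g x) := fun χ x => by simp [ψ]
  have hsemi : ∀ χ g x, ψ χ (ρ g x) = χ g * ψ χ x := by
    intro χ g x
    rw [hψ, hψ, Finset.mul_sum]
    refine Fintype.sum_equiv (Equiv.mulRight g) _ _ fun k => ?_
    rw [Equiv.coe_mulRight, map_mul ρ, Module.End.mul_apply, ← mul_assoc, ← Units.val_mul,
      ← map_mul χ, mul_inv_rev, mul_inv_cancel_left]
  have horth : ∀ g : G, g ≠ 1 → ∑ χ : G →* ℂˣ, (χ g : ℂ) = 0 := by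
    intro g hg
    obtain ⟨φ, hφ⟩ := CommGroup.exists_apply_ne_one_of_hasEnoughRootsOfUnity G ℂ hg
    refine sum_hom_units_eq_zero ((Units.coeHom ℂ).comp (MonoidHom.eval g)) fun h => hφ ?_
    have := DFunLike.congr_fun h φ
    simpa using this
  have hzero : ∑ χ : G →* ℂˣ, ψ χ u = 0 :=
    Finset.sum_eq_zero fun χ _ => hcon χ (ψ χ) (hsemi χ)
  simp only [hψ] at hzero
  rw [Finset.sum_comm] at hzero
  simp only [← Finset.sum_mul] at hzero
  rw [Finset.sum_eq_single 1 (fun g _ hg => by rw [horth _ (inv_ne_one.2 hg), zero_mul])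
    (by simp)] at hzero
  simp [hl] at hzero

/-! ### Characters with prescribed values -/

theorem exists_finset_additive_closure_eq_top (D : Type*) [CommGroup D] [Finite D] :
    ∃ S : Finset (Additive D), S.card = Group.rank D ∧
      AddSubgroup.closure (S : Set (Additive D)) = ⊤ := by
  obtain ⟨S, hS, hcl⟩ := Group.rank_spec D
  refine ⟨S.map Additive.ofMul.toEmbedding, by rw [Finset.card_map, hS], ?_⟩
  have : ⊤ ≤ AddSubgroup.closure (Additive.toMul ⁻¹' (S : Set D)) := by
    rw [← Subgroup.toAddSubgroup_closure, hcl]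
    exact le_rfl
  rw [eq_top_iff]
  refine le_trans this (AddSubgroup.closure_mono fun x hx => ?_)
  simpa using hx

theorem exists_monoidHom_extending_addMonoidHom {D : Type*} [CommGroup D] [Finite D]
    (B : AddSubgroup (Additive D)) (f : B →+ Additive ℂˣ) :
    ∃ η : D →* ℂˣ, ∀ x : B, Additive.ofMul (η x.1.toMul) = f x := by
  let H : Subgroup D := AddSubgroup.toSubgroup' B
  let φ : H →* ℂˣ :=
    { toFun := fun x => (f ⟨Additive.ofMul x.1, x.2⟩).toMul
      map_one' := congrArg Additive.toMul (map_zero f)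
      map_mul' := fun x y => congrArg Additive.toMul
        (map_add f ⟨Additive.ofMul x.1, x.2⟩ ⟨Additive.ofMul y.1, y.2⟩) }
  obtain ⟨η, hη⟩ := MonoidHom.domRestrict_surjective (M := ℂ) H φ
  exact ⟨η, fun x => congrArg Additive.ofMul (DFunLike.congr_fun hη ⟨x.1.toMul, x.2⟩)⟩

/-- The hypothesis makes `χ i ↦ z i` well defined on the subgroup generated by the `χ i`; characters
of subgroups extend to `D`. -/
theorem exists_monoidHom_forall_apply_eq {D ι : Type*} [CommGroup D] [Finite D] (χ : ι → D)
    (z : ι → ℂˣ)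
    (h : ∀ a : ι →₀ ℤ, Finsupp.linearCombination ℤ (fun i => Additive.ofMul (χ i)) a = 0 →
      Finsupp.linearCombination ℤ (fun i => Additive.ofMul (z i)) a = 0) :
    ∃ η : D →* ℂˣ, ∀ i, η (χ i) = z i := by
  set L := Finsupp.linearCombination ℤ (fun i => Additive.ofMul (χ i))
  set Z := Finsupp.linearCombination ℤ (fun i => Additive.ofMul (z i))
  let f : LinearMap.range L →ₗ[ℤ] Additive ℂˣ :=
    (LinearMap.ker L).liftQ Z (fun a ha => h a ha) ∘ₗ L.quotKerEquivRange.symm.toLinearMap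
  have hf : ∀ a, f ⟨L a, a, rfl⟩ = Z a := by
    intro a
    have : L.quotKerEquivRange.symm ⟨L a, a, rfl⟩ = (LinearMap.ker L).mkQ a :=
      (LinearEquiv.symm_apply_eq _).2 rfl
    simp only [f, LinearMap.comp_apply, LinearEquiv.coe_coe, this]
    rfl
  obtain ⟨η, hη⟩ := exists_monoidHom_extending_addMonoidHom (LinearMap.range L).toAddSubgroup
    f.toAddMonoidHom
  refine ⟨η, fun i => ?_⟩
  have hL : L (Finsupp.single i 1) = Additive.ofMul (χ i) := by simp [L]
  have hZ : Z (Finsupp.single i 1) = Additive.ofMul (z i) := by simp [Z]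
  have h1 := (hη ⟨L (Finsupp.single i 1), _, rfl⟩).trans (hf (Finsupp.single i 1))
  rw [hZ] at h1
  simp only [hL] at h1
  exact h1

theorem exists_monoidHom_of_sum_le {D ι : Type*} [CommGroup D] [Finite D] {n d : ℕ}
    (hn : 0 < n) (hd : n * (Group.rank D + 1) ≤ 2 * d + 1) (χ : ι → D) (z : ι → ℂˣ)
    (hχ : ∀ i, χ i ^ n = 1) (hz : ∀ i, z i ^ n = 1)
    (h : ∀ (T : Finset ι) (b : ι → ℕ), ∑ i ∈ T, b i ≤ d → ∏ i ∈ T, χ i ^ b i = 1 →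
      ∏ i ∈ T, z i ^ b i = 1) :
    ∃ η : D →* ℂˣ, ∀ i, η (χ i) = z i := by
  refine exists_monoidHom_forall_apply_eq χ z fun a ha => ?_
  obtain ⟨S, hS, hcl⟩ := exists_finset_additive_closure_eq_top D
  rw [← hS] at hd
  refine linearCombination_eq_zero_of_card_support_le
    (fun _ hp => card_ker_nsmul_le_pow hp S hcl) (fun i => Additive.ofMul (χ i))
    (fun i => Additive.ofMul (z i)) (fun a har ha => ?_) a ha
  refine linearCombination_eq_zero_of_sum_le hn hd (fun i => Additive.ofMul (χ i))
    (fun i => Additive.ofMul (z i)) (fun i => ?_) (fun i => ?_)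
    (fun T b hb hrel => ?_) a har ha
  · rw [← ofMul_pow, hχ, ofMul_one]
  · rw [← ofMul_pow, hz, ofMul_one]
  · simp only [← ofMul_pow, ← ofMul_prod, ofMul_eq_zero] at hrel ⊢
    exact h T b hb hrel

/-! ### Separation of orbits -/

theorem separatesInDegree_of_exponent_le {G V : Type*} [CommGroup G] [Finite G]
    [AddCommGroup V] [Module ℂ V] (ρ : Representation ℂ G V) {d : ℕ}
    (hd : Monoid.exponent G ≤ d) (hd' : Monoid.exponent G * (Group.rank G + 1) ≤ 2 * d + 1) :
    SeparatesInDegree ρ d := by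
  intro v w
  contrapose!
  intro H
  set n := Monoid.exponent G
  have hn : 0 < n := Nat.pos_of_ne_zero Monoid.exponent_ne_zero_of_finite
  have hχn : ∀ χ : G →* ℂˣ, χ ^ n = 1 := fun χ => by
    ext g
    rw [MonoidHom.pow_apply, ← map_pow, Monoid.pow_exponent_eq_one, map_one, MonoidHom.one_apply]
  have hpow : ∀ (χ : G →* ℂˣ) (ψ : Module.Dual ℂ V), (∀ g x, ψ (ρ g x) = χ g * ψ x) →
      ψ v ^ n = ψ w ^ n := by
    intro χ ψ hψ
    have := H _ (by simpa using hd) _ (prod_pow_mem_homogeneousPolyFun (fun _ : Unit => ψ)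
      Finset.univ (fun _ => n)) (isInvariantFun_prod_pow ρ (fun _ => χ) _ (fun _ => hψ) _ _
        (by simpa using hχn χ))
    simpa using this
  -- Functionals vanishing at `v` have no ratio; by `hpow` they also vanish at `w`.
  let ι := {x : (G →* ℂˣ) × Module.Dual ℂ V // (∀ g u, x.2 (ρ g u) = x.1 g * x.2 u) ∧ x.2 v ≠ 0}
  have hw : ∀ i : ι, i.1.2 w ≠ 0 := by
    intro i hi
    have := hpow _ _ i.2.1
    rw [hi, zero_pow hn.ne'] at this
    exact i.2.2 (pow_eq_zero_iff hn.ne' |>.1 this)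
  let z : ι → ℂˣ := fun i => Units.mk0 _ (hw i) / Units.mk0 _ i.2.2
  have hzn : ∀ i, z i ^ n = 1 := by
    intro i
    ext
    simp only [z, div_pow, Units.val_div_eq_div_val, Units.val_pow_eq_pow_val, Units.val_mk0,
      Units.val_one]
    rw [hpow _ _ i.2.1, div_self (pow_ne_zero _ (hw i))]
  obtain ⟨e⟩ := CommGroup.monoidHom_mulEquiv_of_hasEnoughRootsOfUnity G ℂ
  obtain ⟨η, hη⟩ := exists_monoidHom_of_sum_le hn (by rwa [Group.rank_congr e])
    (fun i : ι => i.1.1) z (fun i => hχn i.1.1) hzn (by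
      intro T b hb hrel
      have := H _ hb _ (prod_pow_mem_homogeneousPolyFun (fun i : ι => i.1.2) T b)
        (isInvariantFun_prod_pow ρ _ _ (fun i => i.2.1) _ _ hrel)
      ext
      simp only [z, div_pow, Units.coe_prod, Units.val_div_eq_div_val, Units.val_pow_eq_pow_val,
        Units.val_mk0, Units.val_one, Finset.prod_div_distrib]
      rw [this, div_self (Finset.prod_ne_zero_iff.2 fun i _ => pow_ne_zero _ (hw i))])
  -- A character of the dual group is evaluation at an element of `G`.
  set g := CommGroup.monoidHomMonoidHomEquiv G ℂ η
  have hg : ∀ i : ι, i.1.1 g = z i := fun i => by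
    rw [← hη, CommGroup.apply_monoidHomMonoidHomEquiv]
  refine ⟨g, ?_⟩
  by_contra hne
  obtain ⟨χ, ψ, hψ, hψne⟩ := exists_semiinvariant_functional_ne_zero ρ (sub_ne_zero.2 hne)
  apply hψne
  rw [map_sub, hψ, sub_eq_zero]
  by_cases hv : ψ v = 0
  · have := hpow χ ψ hψ
    rw [hv, zero_pow hn.ne'] at this
    rw [hv, mul_zero, pow_eq_zero_iff hn.ne' |>.1 this.symm]
  · have := congrArg Units.val (hg ⟨(χ, ψ), hψ, hv⟩)
    simp only [z, Units.val_div_eq_div_val, Units.val_mk0] at this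
    rw [this, div_mul_cancel₀ _ hv]

theorem corollary3p2 {G : Type*} [CommGroup G] [Finite G] [Nontrivial G] :
    betaSep G ≤
      ((⌊((Monoid.exponent G : ℚ) * ((Group.rank G : ℚ) + 1)) / 2⌋₊ : ℕ) : ℕ∞) := by
  have hfloor : ⌊((Monoid.exponent G : ℚ) * ((Group.rank G : ℚ) + 1)) / 2⌋₊ =
      Monoid.exponent G * (Group.rank G + 1) / 2 := by
    exact_mod_cast Nat.floor_div_eq_div (K := ℚ) (Monoid.exponent G * (Group.rank G + 1)) 2
  rw [hfloor]
  have hn : 0 < Monoid.exponent G := Nat.pos_of_ne_zero Monoid.exponent_ne_zero_of_finite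
  -- Nontriviality gives rank at least `1`, hence `n ≤ d`, so the invariants `ψ ^ n` are available.
  have hle : Monoid.exponent G * 2 ≤ Monoid.exponent G * (Group.rank G + 1) :=
    Nat.mul_le_mul_left _ (by have := Group.rank_pos G; omega)
  refine iSup_le fun V => iSup_le fun _ => iSup_le fun _ => iSup_le fun _ => iSup_le fun ρ => ?_
  exact iInf₂_le _ ⟨by omega, separatesInDegree_of_exponent_le ρ (by omega) (by omega)⟩
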